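/- All graphs are finite and simple; $e(G)$ denotes the number of edges of $G$, and $P_5$ denotes the path with $5$ edges (on $6$ vertices). For a graph $G$, let $\mathrm{ex}(G,P_5)$ be the maximum number of edges in a subgraph of $G$ that contains no copy of $P_5$ as a (not necessarily induced) subgraph. For a non-negative integer $k$, define the inverse Turán number $$\mathrm{ex}^{-1}(k,P_5)=\sup\{\,e(G) : G \text{ is a graph with } \mathrm{ex}(G,P_5)<k\,\},$$ where the supremum of the empty set is $0$. **Theorem.** The number $\mathrm{ex}^{-1}(k,P_5)$ is finite for every $k$, and $$\mathrm{ex}^{-1}(k,P_5)=\frac{k^2}{8}+O(k)\qquad (k\to\infty).$$ That is, there are constants $C$ and $k_0$ such that $\left|\mathrm{ex}^{-1}(k,P_5)-\frac{k^2}{8}\right|\le Ck$ for all $k\ge k_0$. -/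

import Mathlib

open Filter Asymptotics

/-- The Turán number `ex(G, F)` of a graph `F` in a host graph `G`: the maximum number of edges of
an `F`-free subgraph of `G`. Only the edges of the subgraph matter for its size, so the subgraphs
are taken on the whole vertex set. The value lies in `ℕ∞`, and it is finite if `G` is finite. -/
noncomputable def turanNumber {V W : Type*} (G : SimpleGraph V) (F : SimpleGraph W) : ℕ∞ :=
  sSup {m : ℕ∞ | ∃ H : SimpleGraph V, H ≤ G ∧ F.Free H ∧ m = H.edgeSet.encard}

/-- The inverse Turán number `ex⁻¹(k, F)`: the supremum, possibly infinite, of the number of edges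
of a finite graph `G` with `ex(G, F) < k`. -/
noncomputable def inverseTuranNumber {W : Type*} (k : ℕ) (F : SimpleGraph W) : ℕ∞ :=
  sSup {m : ℕ∞ | ∃ (V : Type) (_ : Finite V) (G : SimpleGraph V),
    turanNumber G F < (k : ℕ∞) ∧ m = G.edgeSet.encard}

/-- The path `P_t` with `t` edges (and `t + 1` vertices). -/
abbrev pathWithEdges (t : ℕ) : SimpleGraph (Fin (t + 1)) :=
  SimpleGraph.pathGraph (t + 1)

/-!
The lower bound comes from complete graphs. By the Erdős–Gallai bound
(`card_edgeFinset_le_of_free`) a `P₅`-free graph on `n` vertices has at most `2n` edges, so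
`ex(Kₙ, P₅) < k` as soon as `2n < k`, and `Kₙ` with `n ≈ k / 2` has `k² / 8 - O(k)` edges.

For the upper bound, let `ex(G, P₅) < k`, and suppose that `m = e(G)` exceeds `k² / 8`. Spanning
star forests are `P₅`-free, so `G` has at most `2k` non-isolated vertices, which form a set `U`
(`card_le_of_turanNumber_lt`). Let `A ⊆ U` maximize the number of inner edges minus `k / 32` times
the size (`exists_dense_core`). Then the graph on `A` has minimum degree at least `k / 32`, a vertex
of `B = U \ A` has at most `k / 32` neighbours in `A`, the graph on `B` is sparse, and
`a = |A| ≥ k / 4`.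

A union of vertex-disjoint graphs, each of whose edges are covered by two vertices, contains no
`P₅`. So, given boundedly many disjoint pairs of hubs in `A`, every other vertex may be joined to
both hubs of one pair (`hubGraph_free`, `hub_yield_le`). Choose the hubs at random. Since the
number `q` of pairs is a large constant, a vertex of `A` with `d` neighbours in `A` gains at least
`1 + d / a` edges on average (`full_tuples_ge`), hence `A` gains `a + 2e(A) / a`. A vertex of `B`
with `d` neighbours in `A` gains at least `4d / a` edges (`seen_tuples_ge`); alternatively, a star
forest inside `B` gains at least `4e(B) / a` edges (`exists_free_subgraph_within`). The average of
the two alternatives for `B` is at least `2(e(A, B) + e(B)) / a`. Up to a constant loss for the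
hubs themselves and for tuples with repeated hubs, this shows `a + 2m / a ≤ k + C`
(`average_yield_le`), so that `m ≤ (k + C)² / 8` by the arithmetic-geometric mean inequality.
-/

/-! ### Paths with five edges -/

/-- `F`-freeness for `F = P₅`, with the copy of `P₅` written out as six distinct vertices. -/
theorem pathWithEdges_five_free_iff {V : Type*} (H : SimpleGraph V) :
    (pathWithEdges 5).Free H ↔ ¬ ∃ v : Fin 6 → V, Function.Injective v ∧
      H.Adj (v 0) (v 1) ∧ H.Adj (v 1) (v 2) ∧ H.Adj (v 2) (v 3) ∧ H.Adj (v 3) (v 4) ∧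
        H.Adj (v 4) (v 5) := by
  rw [SimpleGraph.Free, not_iff_not]
  constructor
  · rintro ⟨f⟩
    refine ⟨f, f.injective, ?_, ?_, ?_, ?_, ?_⟩ <;>
    · apply f.toHom.map_adj
      simp [SimpleGraph.pathGraph_adj]
  · rintro ⟨v, hv, h0, h1, h2, h3, h4⟩
    refine ⟨⟨⟨v, ?_⟩, hv⟩⟩
    intro a b hab
    rw [SimpleGraph.pathGraph_adj] at hab
    have key : ∀ a b : Fin 6, a.val + 1 = b.val → H.Adj (v a) (v b) := by
      intro a b h
      fin_cases a <;> fin_cases b <;> simp at h <;> assumption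
    rcases hab with h | h
    · exact key _ _ h
    · exact (key _ _ h).symm

/-- Six distinct consecutively adjacent vertices cannot occur in a `P₅`-free graph. -/
theorem not_path_of_free {V : Type*} {H : SimpleGraph V} (hH : (pathWithEdges 5).Free H)
    {a b c d e f : V} (hab : H.Adj a b) (hbc : H.Adj b c) (hcd : H.Adj c d) (hde : H.Adj d e)
    (hef : H.Adj e f) (hnd : [a, b, c, d, e, f].Nodup) : False := by
  rw [pathWithEdges_five_free_iff] at hH
  apply hH
  refine ⟨[a, b, c, d, e, f].get, List.nodup_iff_injective_get.1 hnd, ?_⟩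
  exact ⟨hab, hbc, hcd, hde, hef⟩

/-! ### Counting adjacent pairs -/

/-- The number of neighbours of `w` in the set `X`. -/
noncomputable def degIn {V : Type*} (G : SimpleGraph V) (X : Finset V) (w : V) : ℕ :=
  open Classical in (X.filter fun u => G.Adj w u).card

/-- The number of ordered pairs in `X × Y` that are adjacent. -/
noncomputable def adjPairs {V : Type*} (G : SimpleGraph V) (X Y : Finset V) : ℕ :=
  ∑ w ∈ X, degIn G Y w

theorem adjPairs_eq_sum {V : Type*} (G : SimpleGraph V) (X Y : Finset V) :
    adjPairs G X Y = open Classical in ∑ w ∈ X, ∑ u ∈ Y, if G.Adj w u then 1 else 0 := by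
  classical
  simp only [adjPairs, degIn, Finset.card_filter]

theorem adjPairs_comm {V : Type*} (G : SimpleGraph V) (X Y : Finset V) :
    adjPairs G X Y = adjPairs G Y X := by
  classical
  rw [adjPairs_eq_sum, adjPairs_eq_sum, Finset.sum_comm]
  simp [G.adj_comm]

theorem adjPairs_union_left {V : Type*} [DecidableEq V] (G : SimpleGraph V) {X Y : Finset V}
    (Z : Finset V) (h : Disjoint X Y) :
    adjPairs G (X ∪ Y) Z = adjPairs G X Z + adjPairs G Y Z :=
  Finset.sum_union h

theorem adjPairs_union_self {V : Type*} [DecidableEq V] (G : SimpleGraph V) {X Y : Finset V}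
    (h : Disjoint X Y) :
    adjPairs G (X ∪ Y) (X ∪ Y) = adjPairs G X X + 2 * adjPairs G Y X + adjPairs G Y Y := by
  rw [adjPairs_union_left G _ h, adjPairs_comm G X, adjPairs_comm G Y,
    adjPairs_union_left G _ h, adjPairs_union_left G _ h, adjPairs_comm G X Y]
  ring

theorem adjPairs_singleton_left {V : Type*} (G : SimpleGraph V) (w : V) (X : Finset V) :
    adjPairs G {w} X = degIn G X w := by
  simp [adjPairs]

theorem adjPairs_singleton_self {V : Type*} (G : SimpleGraph V) (w : V) :
    adjPairs G {w} {w} = 0 := by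
  classical
  simp [adjPairs, degIn, Finset.filter_singleton]

theorem degIn_add_one_le_card {V : Type*} (G : SimpleGraph V) {X : Finset V} {w : V}
    (hw : w ∈ X) : degIn G X w + 1 ≤ X.card := by
  classical
  exact Finset.card_lt_card (Finset.filter_ssubset.2 ⟨w, hw, G.irrefl⟩)

theorem adjPairs_self_le {V : Type*} (G : SimpleGraph V) (X : Finset V) :
    adjPairs G X X ≤ X.card * (X.card - 1) := by
  rw [adjPairs, ← smul_eq_mul]
  apply Finset.sum_le_card_nsmul
  intro w hw
  have := degIn_add_one_le_card G hw
  omega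

theorem degIn_mono {V : Type*} (G : SimpleGraph V) {X Y : Finset V} (h : X ⊆ Y) (w : V) :
    degIn G X w ≤ degIn G Y w := by
  classical
  exact Finset.card_le_card (Finset.filter_subset_filter _ h)

theorem adjPairs_eq_zero {V : Type*} {G : SimpleGraph V} {X Y : Finset V}
    (h : ∀ x ∈ X, ∀ y ∈ Y, ¬ G.Adj x y) : adjPairs G X Y = 0 := by
  classical
  rw [adjPairs_eq_sum]
  exact Finset.sum_eq_zero fun x hx => Finset.sum_eq_zero fun y hy => if_neg (h x hx y hy)

theorem exists_adj_notMem_of_card_lt_degIn {V : Type*} [DecidableEq V] {G : SimpleGraph V}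
    {X : Finset V} {w : V} {S : Finset V} (h : S.card < degIn G X w) :
    ∃ u ∈ X, G.Adj w u ∧ u ∉ S := by
  classical
  obtain ⟨u, hu, huS⟩ := Finset.exists_mem_notMem_of_card_lt_card (s := S)
    (t := X.filter fun u => G.Adj w u) (by rw [degIn] at h; convert h)
  rw [Finset.mem_filter] at hu
  exact ⟨u, hu.1, hu.2, huS⟩

/-! ### The Erdős–Gallai bound -/

/-- In a `P₅`-free graph, a set of vertices that spans a cycle on five vertices is joined to
no other vertex: the cycle would unroll to a path on six vertices. -/
theorem mem_of_adj_cycle {V : Type*} {H : SimpleGraph V}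
    (hH : (pathWithEdges 5).Free H) {a b c d e : V}
    (hab : H.Adj a b) (hbc : H.Adj b c) (hcd : H.Adj c d) (hde : H.Adj d e) (hea : H.Adj e a)
    (hnd : [a, b, c, d, e].Nodup) {x y : V} (hx : x ∈ [a, b, c, d, e]) (hxy : H.Adj x y) :
    y ∈ [a, b, c, d, e] := by
  by_contra hy
  simp only [List.mem_cons, List.not_mem_nil, or_false, not_or, List.nodup_cons] at hx hy hnd
  obtain ⟨ya, yb, yc, yd, ye⟩ := hy
  rcases hx with rfl | rfl | rfl | rfl | rfl
  · exact not_path_of_free hH hxy.symm hab hbc hcd hde (by grind)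
  · exact not_path_of_free hH hxy.symm hbc hcd hde hea (by grind)
  · exact not_path_of_free hH hxy.symm hcd hde hea hab (by grind)
  · exact not_path_of_free hH hxy.symm hde hea hab hbc (by grind)
  · exact not_path_of_free hH hxy.symm hea hab hbc hcd (by grind)

/-- If the graph that `H` induces on `X` has minimum degree at least three, then a nonempty union of
its components has at most five vertices. A longest path has four or five vertices, and its vertex
set carries a cycle, as in Dirac's theorem; an edge leaving this set would give a longer path. -/
theorem exists_small_closed_of_free {V : Type*} [DecidableEq V] {H : SimpleGraph V}
    (hH : (pathWithEdges 5).Free H) {X : Finset V} (hX : X.Nonempty)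
    (hdeg : ∀ w ∈ X, 2 < degIn H X w) :
    ∃ S ⊆ X, S.Nonempty ∧ S.card ≤ 5 ∧ ∀ x ∈ S, ∀ y ∈ X \ S, ¬ H.Adj y x := by
  have next : ∀ w ∈ X, ∀ p q : V, ∃ u ∈ X, H.Adj w u ∧ u ≠ p ∧ u ≠ q := by
    intro w hw p q
    obtain ⟨u, hu, hwu, hS⟩ := exists_adj_notMem_of_card_lt_degIn (S := {p, q})
      (lt_of_le_of_lt Finset.card_le_two (hdeg w hw))
    exact ⟨u, hu, hwu, by simpa using hS⟩
  have of_cycle : ∀ a b c d e : V, a ∈ X → b ∈ X → c ∈ X → d ∈ X → e ∈ X → H.Adj a b → H.Adj b c →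
      H.Adj c d → H.Adj d e → H.Adj e a → [a, b, c, d, e].Nodup →
      ∃ S ⊆ X, S.Nonempty ∧ S.card ≤ 5 ∧ ∀ x ∈ S, ∀ y ∈ X \ S, ¬ H.Adj y x := by
    intro a b c d e ha hb hc hd he hab hbc hcd hde hea hnd
    refine ⟨[a, b, c, d, e].toFinset, ?_, ⟨a, by simp⟩, List.toFinset_card_le _, ?_⟩
    · intro x hx
      simp at hx
      grind
    · intro x hx y hy hyx
      have := mem_of_adj_cycle hH hab hbc hcd hde hea hnd (List.mem_toFinset.1 hx) hyx.symm
      simp only [Finset.mem_sdiff, List.mem_toFinset] at hy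
      exact hy.2 this
  by_cases h5 : ∃ a ∈ X, ∃ b ∈ X, ∃ c ∈ X, ∃ d ∈ X, ∃ e ∈ X,
      H.Adj a b ∧ H.Adj b c ∧ H.Adj c d ∧ H.Adj d e ∧ [a, b, c, d, e].Nodup
  · obtain ⟨a, ha, b, hb, c, hc, d, hd, e, he, hab, hbc, hcd, hde, hnd⟩ := h5
    by_cases hea : H.Adj e a
    · exact of_cycle a b c d e ha hb hc hd he hab hbc hcd hde hea hnd
    -- Both ends have all their neighbours on the path, so both are adjacent to `b`, `c` and `d`.
    have h1 : H.Adj a c := by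
      obtain ⟨u, hu, hau, hub, hud⟩ := next a ha b d
      by_contra hac
      have hua := hau.ne'
      have huc : u ≠ c := fun h => hac (h ▸ hau)
      have hue : u ≠ e := fun h => hea (h ▸ hau.symm)
      exact not_path_of_free hH hau.symm hab hbc hcd hde
        (List.nodup_cons.2 ⟨by simp [*], hnd⟩)
    have h2 : H.Adj e b := by
      obtain ⟨u, hu, heu, huc, hud⟩ := next e he c d
      by_contra heb
      have hue := heu.ne'
      have hub : u ≠ b := fun h => heb (h ▸ heu)
      have hua : u ≠ a := fun h => hea (h ▸ heu)
      have hnd' : [e, d, c, b, a].Nodup := List.nodup_reverse.1 hnd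
      exact not_path_of_free hH heu.symm hde.symm hcd.symm hbc.symm hab.symm
        (List.nodup_cons.2 ⟨by simp [*], hnd'⟩)
    refine of_cycle a c d e b ha hc hd he hb h1 hcd hde h2 hab.symm ?_
    clear of_cycle next hdeg
    simp only [List.nodup_cons, List.mem_cons] at hnd ⊢
    grind
  · obtain ⟨a, ha⟩ := hX
    obtain ⟨b, hb, hab, -, -⟩ := next a ha a a
    obtain ⟨c, hc, hbc, hca, -⟩ := next b hb a a
    obtain ⟨d, hd, hcd, hda, hdb⟩ := next c hc a b
    -- No path on four vertices extends, so `d` is adjacent to `a`.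
    have hda' : H.Adj d a := by
      obtain ⟨u, hu, hdu, hub, huc⟩ := next d hd b c
      by_contra hne
      have hua : u ≠ a := fun h => hne (h ▸ hdu)
      refine h5 ⟨a, ha, b, hb, c, hc, d, hd, u, hu, hab, hbc, hcd, hdu, ?_⟩
      have := hdu.ne
      simp [*, hab.ne, hbc.ne, hcd.ne, hca.symm, hda.symm, hdb.symm, hua.symm, hub.symm,
        huc.symm]
    refine ⟨{a, b, c, d}, ?_, ⟨a, by simp⟩, Finset.card_le_four.trans (by norm_num), ?_⟩
    · intro x hx
      simp at hx
      grind
    · intro x hx y hy hyx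
      simp only [Finset.mem_sdiff, Finset.mem_insert, Finset.mem_singleton, not_or] at hx hy
      obtain ⟨hyX, ya, yb, yc, yd⟩ := hy
      have hne := And.intro hab.ne <| And.intro hab.ne' <| And.intro hbc.ne <| And.intro hbc.ne' <|
        And.intro hcd.ne <| And.intro hcd.ne' <| And.intro hca.symm <| And.intro hda.symm hdb.symm
      rcases hx with rfl | rfl | rfl | rfl
      · exact h5 ⟨y, hyX, x, ha, b, hb, c, hc, d, hd, hyx, hab, hbc, hcd,
          by simp [*]⟩
      · exact h5 ⟨y, hyX, x, hb, c, hc, d, hd, a, ha, hyx, hbc, hcd, hda',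
          by simp [*]⟩
      · exact h5 ⟨y, hyX, x, hc, d, hd, a, ha, b, hb, hyx, hcd, hda', hab,
          by simp [*]⟩
      · exact h5 ⟨y, hyX, x, hd, a, ha, b, hb, c, hc, hyx, hda', hab, hbc,
          by simp [*]⟩

/-- The Erdős–Gallai bound for `P₅`, with every edge counted twice. -/
theorem adjPairs_le_of_free {V : Type*} {H : SimpleGraph V}
    (hH : (pathWithEdges 5).Free H) (X : Finset V) : adjPairs H X X ≤ 4 * X.card := by
  classical
  induction X using Finset.strongInduction with
  | H X ih =>
    rcases X.eq_empty_or_nonempty with rfl | hX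
    · simp [adjPairs]
    by_cases hdeg : ∃ w ∈ X, degIn H X w ≤ 2
    · obtain ⟨w, hw, hd⟩ := hdeg
      have h1 := ih _ (Finset.erase_ssubset hw)
      have hdisj : Disjoint (X.erase w) {w} := by simp
      have h2 := adjPairs_union_self H hdisj
      have h3 : X.erase w ∪ {w} = X := by
        ext x; by_cases h : x = w <;> simp [h, hw]
      have h4 : degIn H (X.erase w) w ≤ degIn H X w :=
        degIn_mono H (Finset.erase_subset _ _) w
      rw [h3, adjPairs_singleton_left, adjPairs_singleton_self] at h2
      have h5 := Finset.card_erase_add_one hw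
      omega
    · push Not at hdeg
      obtain ⟨S, hSX, hS, hS5, hclosed⟩ := exists_small_closed_of_free hH hX hdeg
      have h1 := ih _ (Finset.sdiff_ssubset hSX hS)
      have h2 := adjPairs_union_self H (Finset.disjoint_sdiff (s := S) (t := X))
      rw [Finset.union_sdiff_of_subset hSX,
        adjPairs_eq_zero (fun x hx y hy => hclosed y hy x hx)] at h2
      have h3 := adjPairs_self_le H S
      have h4 : S.card * (S.card - 1) ≤ S.card * 4 := Nat.mul_le_mul_left _ (by omega)
      have h5 := Finset.card_sdiff_add_card_eq_card hSX
      omega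

theorem adjPairs_univ {V : Type*} [Fintype V] (G : SimpleGraph V) [Fintype G.edgeSet] :
    adjPairs G Finset.univ Finset.univ = 2 * G.edgeFinset.card := by
  classical
  have := G.sum_degrees_eq_twice_card_edges
  refine Eq.trans (Finset.sum_congr rfl fun w _ => ?_) (this.trans (by congr!))
  rw [degIn, ← G.card_neighborFinset_eq_degree, G.neighborFinset_eq_filter]

/-- The Erdős–Gallai bound: a `P₅`-free graph on `n` vertices has at most `2n` edges. -/
theorem card_edgeFinset_le_of_free {V : Type*} [Fintype V] {H : SimpleGraph V}
    [Fintype H.edgeSet] (hH : (pathWithEdges 5).Free H) :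
    H.edgeFinset.card ≤ 2 * Fintype.card V := by
  have h1 := adjPairs_le_of_free hH Finset.univ
  rw [adjPairs_univ, Finset.card_univ] at h1
  omega

/-! ### Spanning star forests -/

theorem card_edgeFinset_lt_of_turanNumber_lt {V W : Type*} {G : SimpleGraph V}
    {F : SimpleGraph W} {k : ℕ} (h : turanNumber G F < k) {H : SimpleGraph V} [Fintype H.edgeSet]
    (hHG : H ≤ G) (hH : F.Free H) : H.edgeFinset.card < k := by
  have h1 : H.edgeSet.encard ≤ turanNumber G F := le_sSup ⟨H, hHG, hH, rfl⟩
  have h2 := h1.trans_lt h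
  rw [← SimpleGraph.coe_edgeFinset, Set.encard_coe_eq_coe_finsetCard] at h2
  exact_mod_cast h2

/-- Every finite graph has a `P₅`-free subgraph with the same non-isolated vertices. A minimal
subgraph with these non-isolated vertices is a star forest: the middle edge of a path with three
edges could be deleted. -/
theorem exists_free_spanning_subgraph {V : Type*} [Finite V] (G : SimpleGraph V) :
    ∃ S ≤ G, (pathWithEdges 5).Free S ∧ ∀ v, (∃ u, G.Adj v u) → ∃ u, S.Adj v u := by
  obtain ⟨S, ⟨hSG, hS⟩, hmin⟩ := (Set.toFinite
    {S : SimpleGraph V | S ≤ G ∧ ∀ v, (∃ u, G.Adj v u) → ∃ u, S.Adj v u}).exists_minimal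
    ⟨G, le_rfl, fun _ h => h⟩
  refine ⟨S, hSG, ?_, hS⟩
  rw [pathWithEdges_five_free_iff]
  rintro ⟨v, hv, h0, h1, h2, -, -⟩
  have h02 : v 0 ≠ v 2 := hv.ne (by decide)
  have h13 : v 1 ≠ v 3 := hv.ne (by decide)
  have key : S ≤ S.deleteEdges {s(v 1, v 2)} := by
    refine hmin ⟨(S.deleteEdges_le _).trans hSG, fun w hw => ?_⟩ (S.deleteEdges_le _)
    obtain ⟨u, hu⟩ := hS w hw
    by_cases hw1 : w = v 1
    · subst hw1
      refine ⟨v 0, ?_⟩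
      simp only [SimpleGraph.deleteEdges_adj, Set.mem_singleton_iff, Sym2.eq_iff]
      refine ⟨h0.symm, ?_⟩
      have := h0.ne
      have := h1.ne
      grind
    by_cases hw2 : w = v 2
    · subst hw2
      refine ⟨v 3, ?_⟩
      simp only [SimpleGraph.deleteEdges_adj, Set.mem_singleton_iff, Sym2.eq_iff]
      refine ⟨h2, ?_⟩
      have := h1.ne
      grind
    refine ⟨u, ?_⟩
    simp only [SimpleGraph.deleteEdges_adj, Set.mem_singleton_iff, Sym2.eq_iff]
    refine ⟨hu, ?_⟩
    grind
  have := key h1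
  simp [SimpleGraph.deleteEdges_adj] at this

theorem card_le_twice_card_edgeFinset {V : Type*} [Fintype V] {S : SimpleGraph V}
    [Fintype S.edgeSet] {X : Finset V} (hX : ∀ v ∈ X, ∃ u, S.Adj v u) :
    X.card ≤ 2 * S.edgeFinset.card := by
  classical
  rw [← adjPairs_univ, Finset.card_eq_sum_ones]
  refine le_trans (Finset.sum_le_sum fun v hv => ?_)
    (Finset.sum_le_sum_of_subset (Finset.subset_univ X))
  obtain ⟨u, hu⟩ := hX v hv
  exact Finset.card_pos.2 ⟨u, by simpa using hu⟩

/-- A graph with `ex(G, P₅) < k` has at most `2k` non-isolated vertices. -/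
theorem card_le_of_turanNumber_lt {V : Type*} [Fintype V] {G : SimpleGraph V} {k : ℕ}
    (h : turanNumber G (pathWithEdges 5) < k) {X : Finset V} (hX : ∀ v ∈ X, ∃ u, G.Adj v u) :
    X.card ≤ 2 * k := by
  classical
  obtain ⟨S, hSG, hS, hcov⟩ := exists_free_spanning_subgraph G
  have h1 := card_edgeFinset_lt_of_turanNumber_lt h hSG hS
  have h2 := card_le_twice_card_edgeFinset fun v hv => hcov v (hX v hv)
  omega

/-! ### Subgraphs attached to pairs of hubs -/

/-- The subgraph of `G` on `X` attached to a family of pairs of hubs `h (i, true)`, `h (i, false)`: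
every vertex `x` belongs to the class `c x`, and the edges kept are those inside a class with at
least one end in a hub. -/
def hubGraph {V ι : Type*} (G : SimpleGraph V) (X : Finset V) (h : ι × Bool → V) (c : V → ι) :
    SimpleGraph V where
  Adj x y := G.Adj x y ∧ c x = c y ∧ (x ∈ Set.range h ∨ y ∈ Set.range h) ∧ x ∈ X ∧ y ∈ X
  symm := ⟨fun _ _ ⟨h1, h2, h3, h4, h5⟩ => ⟨h1.symm, h2.symm, h3.symm, h5, h4⟩⟩
  loopless := ⟨fun _ h => G.irrefl h.1⟩

/-- The edges of a connected subgraph of `hubGraph` are covered by two vertices, while `P₅` has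
three disjoint edges. -/
theorem hubGraph_free {V ι : Type*} (G : SimpleGraph V) (X : Finset V) (h : ι × Bool → V)
    (c : V → ι) (hc : ∀ p, c (h p) = p.1) : (pathWithEdges 5).Free (hubGraph G X h c) := by
  rw [pathWithEdges_five_free_iff]
  rintro ⟨v, hv, h0, h1, h2, h3, h4⟩
  have key : ∀ j l : Fin 6, c (v j) = c (v 0) → (hubGraph G X h c).Adj (v j) (v l) →
      ∃ m b, (m = j ∨ m = l) ∧ v m = h (c (v 0), b) := by
    rintro j l hj ⟨-, hjl, ⟨⟨i, b⟩, hp⟩ | ⟨⟨i, b⟩, hp⟩, -, -⟩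
    · refine ⟨j, b, Or.inl rfl, ?_⟩
      rw [← hj, ← hp, hc]
    · refine ⟨l, b, Or.inr rfl, ?_⟩
      rw [← hj, hjl, ← hp, hc]
  have c1 := h0.2.1
  have c2 := c1.trans h1.2.1
  have c3 := c2.trans h2.2.1
  have c4 := c3.trans h3.2.1
  obtain ⟨m, b, hm, hmb⟩ := key 0 1 rfl h0
  obtain ⟨m', b', hm', hmb'⟩ := key 2 3 c2.symm h2
  obtain ⟨m'', b'', hm'', hmb''⟩ := key 4 5 c4.symm h4
  have hb : b = b' ∨ b = b'' ∨ b' = b'' := by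
    cases b <;> cases b' <;> cases b'' <;> simp
  rcases hb with rfl | rfl | rfl
  · have := hv (hmb.trans hmb'.symm)
    rcases hm with rfl | rfl <;> rcases hm' with rfl | rfl <;> revert this <;> decide
  · have := hv (hmb.trans hmb''.symm)
    rcases hm with rfl | rfl <;> rcases hm'' with rfl | rfl <;> revert this <;> decide
  · have := hv (hmb'.trans hmb''.symm)
    rcases hm' with rfl | rfl <;> rcases hm'' with rfl | rfl <;> revert this <;> decide

theorem free_sup_of_disjoint {V : Type*} {H S : SimpleGraph V} (X : Finset V)
    (hHX : ∀ x y, H.Adj x y → x ∈ X) (hSX : ∀ x y, S.Adj x y → x ∉ X)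
    (hH : (pathWithEdges 5).Free H) (hS : (pathWithEdges 5).Free S) :
    (pathWithEdges 5).Free (H ⊔ S) := by
  rw [pathWithEdges_five_free_iff] at *
  rintro ⟨v, hv, h0, h1, h2, h3, h4⟩
  have inH : ∀ x y, (H ⊔ S).Adj x y → x ∈ X → H.Adj x y ∧ y ∈ X := by
    rintro x y (h | h) hx
    · exact ⟨h, hHX _ _ h.symm⟩
    · exact absurd hx (hSX _ _ h)
  have inS : ∀ x y, (H ⊔ S).Adj x y → x ∉ X → S.Adj x y ∧ y ∉ X := by
    rintro x y (h | h) hx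
    · exact absurd (hHX _ _ h) hx
    · exact ⟨h, hSX _ _ h.symm⟩
  by_cases hx : v 0 ∈ X
  · obtain ⟨e0, hx⟩ := inH _ _ h0 hx
    obtain ⟨e1, hx⟩ := inH _ _ h1 hx
    obtain ⟨e2, hx⟩ := inH _ _ h2 hx
    obtain ⟨e3, hx⟩ := inH _ _ h3 hx
    exact hH ⟨v, hv, e0, e1, e2, e3, (inH _ _ h4 hx).1⟩
  · obtain ⟨e0, hx⟩ := inS _ _ h0 hx
    obtain ⟨e1, hx⟩ := inS _ _ h1 hx
    obtain ⟨e2, hx⟩ := inS _ _ h2 hx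
    obtain ⟨e3, hx⟩ := inS _ _ h3 hx
    exact hS ⟨v, hv, e0, e1, e2, e3, (inS _ _ h4 hx).1⟩

theorem card_edgeFinset_sup_of_disjoint {V : Type*} [Fintype V] [DecidableEq V]
    {H S : SimpleGraph V} [Fintype H.edgeSet] [Fintype S.edgeSet] [Fintype (H ⊔ S).edgeSet]
    (X : Finset V) (hHX : ∀ x y, H.Adj x y → x ∈ X) (hSX : ∀ x y, S.Adj x y → x ∉ X) :
    (H ⊔ S).edgeFinset.card = H.edgeFinset.card + S.edgeFinset.card := by
  have hd : Disjoint H.edgeFinset S.edgeFinset := by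
    rw [Finset.disjoint_left]
    intro e he he'
    induction e with
    | _ x y =>
      rw [SimpleGraph.mem_edgeFinset, SimpleGraph.mem_edgeSet] at he he'
      exact hSX _ _ he' (hHX _ _ he)
  rw [SimpleGraph.edgeFinset_sup, Finset.card_union_of_disjoint hd]

theorem sum_le_card_edgeFinset_hubGraph {V ι : Type*} [Fintype V] (G : SimpleGraph V)
    (X : Finset V) (h : ι × Bool → V) (c : V → ι) (hinj : Function.Injective h)
    (hc : ∀ p, c (h p) = p.1) (hX : ∀ p, h p ∈ X) [Fintype (hubGraph G X h c).edgeSet]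
    [DecidableRel G.Adj] [DecidablePred (· ∈ Set.range h)] :
    (∑ w ∈ X with w ∉ Set.range h, (Finset.univ.filter fun b => G.Adj w (h (c w, b))).card) ≤
      (hubGraph G X h c).edgeFinset.card := by
  rw [← Finset.card_sigma]
  refine Finset.card_le_card_of_injOn (fun p => s(p.1, h (c p.1, p.2))) ?_ ?_
  · rintro ⟨w, b⟩ hp
    simp only [Finset.coe_sigma, Set.mem_sigma_iff, Finset.mem_coe, Finset.mem_filter,
      Finset.mem_univ, true_and] at hp
    simp only [SimpleGraph.coe_edgeFinset, SimpleGraph.mem_edgeSet]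
    exact ⟨hp.2, (hc (c w, b)).symm, Or.inr ⟨_, rfl⟩, hp.1.1, hX _⟩
  · rintro ⟨w, b⟩ hp ⟨w', b'⟩ hp' heq
    simp only [Finset.coe_sigma, Set.mem_sigma_iff, Finset.mem_coe, Finset.mem_filter,
      Finset.mem_univ, true_and] at hp hp'
    rcases Sym2.eq_iff.1 heq with ⟨h1, h2⟩ | ⟨h1, -⟩
    · have h3 := congrArg Prod.snd (hinj h2)
      simp only at h1 h3
      rw [h1, h3]
    · exact absurd ⟨_, h1.symm⟩ hp.1.2

/-- The classes can be chosen so that a vertex is assigned to a pair of hubs to which it sends as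
many edges as possible. -/
theorem exists_class {V ι : Type*} [Nonempty ι] (G : SimpleGraph V) (h : ι × Bool → V)
    (hinj : Function.Injective h) :
    ∃ c : V → ι, (∀ p, c (h p) = p.1) ∧ ∀ w ∉ Set.range h,
      ((∃ i, ∀ b, G.Adj w (h (i, b))) → ∀ b, G.Adj w (h (c w, b))) ∧
      ((∃ i b, G.Adj w (h (i, b))) → ∃ b, G.Adj w (h (c w, b))) := by
  have : ∀ w, ∃ i : ι, (∀ p, h p = w → i = p.1) ∧ (w ∉ Set.range h →
      ((∃ i, ∀ b, G.Adj w (h (i, b))) → ∀ b, G.Adj w (h (i, b))) ∧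
      ((∃ i b, G.Adj w (h (i, b))) → ∃ b, G.Adj w (h (i, b)))) := by
    intro w
    by_cases hw : w ∈ Set.range h
    · obtain ⟨p, rfl⟩ := hw
      exact ⟨p.1, fun p' hp' => by rw [hinj hp'], fun h' => absurd ⟨p, rfl⟩ h'⟩
    have hw' : ∀ i : ι, ∀ p, h p = w → i = p.1 := fun i p hp => absurd ⟨p, hp⟩ hw
    by_cases hfull : ∃ i, ∀ b, G.Adj w (h (i, b))
    · obtain ⟨i, hi⟩ := hfull
      exact ⟨i, hw' i, fun _ => ⟨fun _ => hi, fun _ => ⟨true, hi true⟩⟩⟩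
    by_cases hseen : ∃ i b, G.Adj w (h (i, b))
    · obtain ⟨i, hi⟩ := hseen
      exact ⟨i, hw' i, fun _ => ⟨fun h' => absurd h' hfull, fun _ => hi⟩⟩
    · exact ⟨Classical.arbitrary ι, hw' _, fun _ =>
        ⟨fun h' => absurd h' hfull, fun h' => absurd h' hseen⟩⟩
  choose c hc1 hc2 using this
  exact ⟨c, fun p => hc1 _ p rfl, hc2⟩

/-- The yield of a family of pairs of hubs in `A`: a vertex of `A` adjacent to both hubs of a pair
contributes two edges, a vertex of `X \ A` adjacent to some hub contributes one, and the edges of a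
`P₅`-free graph `S` outside `X` can be added. The error term accounts for the hubs themselves. -/
theorem hub_yield_le {V ι : Type*} [Fintype V] [Fintype ι] [Nonempty ι] [DecidableEq V]
    {G : SimpleGraph V} [DecidableRel G.Adj] {k : ℕ} (hk : turanNumber G (pathWithEdges 5) < k)
    {A X : Finset V} (hAX : A ⊆ X) {h : ι × Bool → V} (hinj : Function.Injective h)
    (hA : ∀ p, h p ∈ A) {S : SimpleGraph V} [Fintype S.edgeSet] (hSG : S ≤ G)
    (hS : (pathWithEdges 5).Free S) (hSX : ∀ x y, S.Adj x y → x ∉ X) :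
    2 * (A.filter fun w => ∃ i, ∀ b, G.Adj w (h (i, b))).card +
      ((X \ A).filter fun w => ∃ i b, G.Adj w (h (i, b))).card + S.edgeFinset.card ≤
      k + 4 * Fintype.card ι := by
  classical
  obtain ⟨c, hc, hmax⟩ := exists_class G h hinj
  have hHX : ∀ x y, (hubGraph G X h c).Adj x y → x ∈ X := fun x y hxy => hxy.2.2.2.1
  have h1 := card_edgeFinset_lt_of_turanNumber_lt (H := hubGraph G X h c ⊔ S) hk
    (sup_le (fun x y hxy => hxy.1) hSG)
    (free_sup_of_disjoint X hHX hSX (hubGraph_free G X h c hc) hS)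
  rw [card_edgeFinset_sup_of_disjoint X hHX hSX] at h1
  have h2 := sum_le_card_edgeFinset_hubGraph G X h c hinj hc (fun p => hAX (hA p))
  have hsplit : (X.filter fun w => w ∉ Set.range h) =
      (A.filter fun w => w ∉ Set.range h) ∪ (X \ A) := by
    ext w
    simp only [Finset.mem_filter, Finset.mem_union, Finset.mem_sdiff]
    constructor
    · rintro ⟨hw, hr⟩
      by_cases hwA : w ∈ A
      · exact Or.inl ⟨hwA, hr⟩
      · exact Or.inr ⟨hw, hwA⟩
    · rintro (⟨hw, hr⟩ | ⟨hw, hwA⟩)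
      · exact ⟨hAX hw, hr⟩
      · exact ⟨hw, fun ⟨p, hp⟩ => hwA (hp ▸ hA p)⟩
  rw [hsplit, Finset.sum_union (Finset.disjoint_left.2 fun w hw hw' =>
    (Finset.mem_sdiff.1 hw').2 (Finset.mem_filter.1 hw).1)] at h2
  have h3 : ((X \ A).filter fun w => ∃ i b, G.Adj w (h (i, b))).card ≤
      ∑ w ∈ X \ A, (Finset.univ.filter fun b => G.Adj w (h (c w, b))).card := by
    rw [Finset.card_filter]
    refine Finset.sum_le_sum fun w hw => ?_
    split_ifs with hw'
    · obtain ⟨b, hb⟩ := (hmax w fun ⟨p, hp⟩ => (Finset.mem_sdiff.1 hw).2 (hp ▸ hA p)).2 hw'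
      exact Finset.card_pos.2 ⟨b, by simpa using hb⟩
    · exact Nat.zero_le _
  have h4 : 2 * ((A.filter fun w => w ∉ Set.range h).filter
        fun w => ∃ i, ∀ b, G.Adj w (h (i, b))).card ≤
      ∑ w ∈ A with w ∉ Set.range h,
        (Finset.univ.filter fun b => G.Adj w (h (c w, b))).card := by
    rw [Finset.card_filter, Finset.mul_sum]
    refine Finset.sum_le_sum fun w hw => ?_
    split_ifs with hw'
    · rw [Finset.filter_true_of_mem fun b _ =>
        (hmax w (Finset.mem_filter.1 hw).2).1 hw' b]
      simp
    · exact Nat.zero_le _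
  have h5 : (A.filter fun w => ∃ i, ∀ b, G.Adj w (h (i, b))).card ≤
      ((A.filter fun w => w ∉ Set.range h).filter
        fun w => ∃ i, ∀ b, G.Adj w (h (i, b))).card + 2 * Fintype.card ι := by
    have hr : (Finset.univ.image h).card ≤ 2 * Fintype.card ι := by
      refine Finset.card_image_le.trans ?_
      simp [mul_comm]
    refine le_trans (Finset.card_le_card (t := _ ∪ Finset.univ.image h) fun w hw => ?_)
      ((Finset.card_union_le _ _).trans (Nat.add_le_add_left hr _))
    rw [Finset.mem_filter] at hw
    rw [Finset.mem_union]
    by_cases hwr : w ∈ Set.range h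
    · obtain ⟨p, rfl⟩ := hwr
      exact Or.inr (Finset.mem_image_of_mem _ (Finset.mem_univ _))
    · exact Or.inl (Finset.mem_filter.2 ⟨Finset.mem_filter.2 ⟨hw.1, hwr⟩, hw.2⟩)
  omega

/-! ### Averaging over tuples of hubs -/

/-- Two given entries of a random tuple agree with probability at most `1 / |α|`. -/
theorem card_eq_apply_mul_card_le {γ α : Type*} [Fintype γ] [Fintype α] [DecidableEq γ]
    [DecidableEq α] {x y : γ} (hxy : x ≠ y) :
    (Finset.univ.filter fun f : γ → α => f x = f y).card * Fintype.card α ≤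
      Fintype.card α ^ Fintype.card γ := by
  rw [← Fintype.card_fun, ← Finset.card_univ (α := α), ← Finset.card_product,
    ← Finset.card_univ (α := γ → α)]
  -- Overwriting the value at `y` loses no information, as it agrees with the value at `x`.
  refine Finset.card_le_card_of_injOn (fun p => Function.update p.1 y p.2) (by simp) ?_
  rintro ⟨f, u⟩ hf ⟨g, v⟩ hg heq
  simp only [Finset.coe_product, Set.mem_prod, Finset.mem_coe, Finset.mem_filter,
    Finset.mem_univ, true_and, and_true] at hf hg
  have h1 : ∀ z, Function.update f y u z = Function.update g y v z := fun z => congrFun heq z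
  have h2 : ∀ z, z ≠ y → f z = g z := by
    intro z hz
    simpa [hz] using h1 z
  have h3 : f = g := by
    funext z
    by_cases hz : z = y
    · rw [hz, ← hf, ← hg, h2 x hxy]
    · exact h2 z hz
  have h4 : u = v := by simpa using h1 y
  rw [h3, h4]

theorem card_not_injective_mul_card_le {γ α : Type*} [Fintype γ] [Fintype α] [DecidableEq γ]
    [DecidableEq α] [DecidablePred fun f : γ → α => Function.Injective f] :
    (Finset.univ.filter fun f : γ → α => ¬ Function.Injective f).card * Fintype.card α ≤
      Fintype.card γ ^ 2 * Fintype.card α ^ Fintype.card γ := by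
  have hsub : (Finset.univ.filter fun f : γ → α => ¬ Function.Injective f) ⊆
      (Finset.univ.filter fun p : γ × γ => p.1 ≠ p.2).biUnion
        fun p => Finset.univ.filter fun f : γ → α => f p.1 = f p.2 := by
    intro f hf
    have hf' := (Finset.mem_filter.1 hf).2
    rw [Function.Injective] at hf'
    push Not at hf'
    obtain ⟨x, y, hxy, hne⟩ := hf'
    simp only [Finset.mem_biUnion, Finset.mem_filter, Finset.mem_univ, true_and]
    exact ⟨(x, y), hne, hxy⟩
  have h1 := (Finset.card_le_card hsub).trans Finset.card_biUnion_le
  refine (Nat.mul_le_mul_right _ h1).trans ?_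
  rw [Finset.sum_mul]
  refine (Finset.sum_le_card_nsmul _ _ (Fintype.card α ^ Fintype.card γ) fun p hp =>
    card_eq_apply_mul_card_le (by simpa using hp)).trans ?_
  rw [smul_eq_mul]
  refine Nat.mul_le_mul_right _ ((Finset.card_filter_le _ _).trans ?_)
  simp [sq]

/-- If `F` is at most `M` on injective tuples and at most `M'` on all tuples, then its average
over all tuples is at most `M + O(M' / |α|)`. -/
theorem card_mul_sum_le_of_injective {γ α : Type*} [Fintype γ] [Fintype α] [DecidableEq γ]
    {F : (γ → α) → ℝ} {M M' : ℝ} (hM : 0 ≤ M) (hM' : 0 ≤ M')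
    (h : ∀ f, Function.Injective f → F f ≤ M) (h' : ∀ f, F f ≤ M') :
    (Fintype.card α : ℝ) * ∑ f, F f ≤
      (Fintype.card α : ℝ) ^ Fintype.card γ *
        (Fintype.card α * M + (Fintype.card γ : ℝ) ^ 2 * M') := by
  classical
  have h1 := card_not_injective_mul_card_le (γ := γ) (α := α)
  have h2 : ∑ f, F f ≤ ∑ f : γ → α, (M + if ¬ Function.Injective f then M' else 0) := by
    refine Finset.sum_le_sum fun f _ => ?_
    split_ifs with hf
    · linarith [h f hf]
    · linarith [h' f]
  rw [Finset.sum_add_distrib, Finset.sum_const, ← Finset.sum_filter, Finset.sum_const,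
    Finset.card_univ, Fintype.card_fun, nsmul_eq_mul, nsmul_eq_mul] at h2
  have h3 : ((Finset.univ.filter fun f : γ → α => ¬ Function.Injective f).card : ℝ) *
      Fintype.card α ≤ (Fintype.card γ : ℝ) ^ 2 * (Fintype.card α : ℝ) ^ Fintype.card γ := by
    exact_mod_cast h1
  have h4 := mul_le_mul_of_nonneg_left h2 (Nat.cast_nonneg (α := ℝ) (Fintype.card α))
  have h5 := mul_le_mul_of_nonneg_right h3 hM'
  push_cast at h4
  linarith

theorem card_forall_not_full {ι α : Type*} [Fintype ι] [Fintype α] [DecidableEq ι]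
    (P : α → Prop) [DecidablePred P] :
    (Finset.univ.filter fun f : ι × Bool → α => ∀ i, ¬ ∀ b, P (f (i, b))).card =
      (Fintype.card α ^ 2 - (Finset.univ.filter P).card ^ 2) ^ Fintype.card ι := by
  classical
  have h1 : (Finset.univ.filter fun g : Bool → α => ∀ b, P (g b)).card =
      (Finset.univ.filter P).card ^ 2 := by
    have : (Finset.univ.filter fun g : Bool → α => ∀ b, P (g b)) =
        Fintype.piFinset fun _ => Finset.univ.filter P := by
      ext g; simp [Fintype.mem_piFinset]
    rw [this, Fintype.card_piFinset, Finset.prod_const, Finset.card_univ, Fintype.card_bool]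
  have h2 : (Finset.univ.filter fun g : Bool → α => ¬ ∀ b, P (g b)).card =
      Fintype.card α ^ 2 - (Finset.univ.filter P).card ^ 2 := by
    rw [← h1, Finset.filter_not, ← Finset.compl_eq_univ_sdiff, Finset.card_compl,
      Fintype.card_fun, Fintype.card_bool]
  rw [← h2, ← Finset.card_univ (α := ι), ← Finset.prod_const, ← Fintype.card_piFinset]
  refine Finset.card_equiv (Equiv.curry ι Bool α) fun f => ?_
  rw [Fintype.mem_piFinset]
  simp

theorem card_forall_not_seen {ι α : Type*} [Fintype ι] [Fintype α] [DecidableEq ι]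
    (P : α → Prop) [DecidablePred P] :
    (Finset.univ.filter fun f : ι × Bool → α => ∀ i b, ¬ P (f (i, b))).card =
      (Fintype.card α - (Finset.univ.filter P).card) ^ (2 * Fintype.card ι) := by
  classical
  have h1 : (Finset.univ.filter fun g : α => ¬ P g).card =
      Fintype.card α - (Finset.univ.filter P).card := by
    rw [Finset.filter_not, ← Finset.compl_eq_univ_sdiff, Finset.card_compl]
  have h2 : Fintype.card (ι × Bool) = 2 * Fintype.card ι := by simp [mul_comm]
  rw [← h1, ← h2, ← Finset.card_univ (α := ι × Bool), ← Finset.prod_const,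
    ← Fintype.card_piFinset]
  congr 1
  ext g
  simp [Fintype.mem_piFinset]

theorem card_filter_eq_card_sub {β : Type*} [Fintype β] (p : β → Prop) [DecidablePred p] :
    ((Finset.univ.filter p).card : ℝ) =
      Fintype.card β - (Finset.univ.filter fun x => ¬ p x).card := by
  have := Finset.card_filter_add_card_filter_not (s := (Finset.univ : Finset β)) p
  rw [Finset.card_univ] at this
  rw [← this]
  push_cast
  ring

theorem four_mul_le_one_sub_pow {x : ℝ} (hx : 0 ≤ x) (hx' : x ≤ 1 / 8) {N : ℕ} (hN : 8 ≤ N) :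
    4 * x ≤ 1 - (1 - x) ^ N := by
  have h1 : (1 - x) ^ N ≤ (1 - x) ^ 8 :=
    pow_le_pow_of_le_one (by linarith) (by linarith) hN
  have h2 : (1 - x) ^ 2 ≤ 1 - 15 / 8 * x := by nlinarith
  have h4 : ((1 - x) ^ 2) ^ 2 ≤ 1 - 3 * x := by
    have := pow_le_pow_left₀ (sq_nonneg _) h2 2
    nlinarith
  have h8 : (((1 - x) ^ 2) ^ 2) ^ 2 ≤ 1 - 4 * x := by
    have := pow_le_pow_left₀ (sq_nonneg _) h4 2
    nlinarith
  have h9 : (1 - x) ^ 8 = (((1 - x) ^ 2) ^ 2) ^ 2 := by ring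
  linarith

/-- A number of pairs that suffices for all relative degrees `y ≥ 1 / 64`. The bound is linear in
`y`, so that it can be summed over the vertices, and it is attained at `y = 1`, so that nothing is
lost on complete graphs. -/
theorem exists_two_mul_one_sub_sq_pow_le :
    ∃ q : ℕ, 4 ≤ q ∧ ∀ y : ℝ, 1 / 64 ≤ y → y ≤ 1 → 2 * (1 - y ^ 2) ^ q ≤ 1 - y := by
  obtain ⟨n, hn⟩ := exists_pow_lt_of_lt_one (show (0 : ℝ) < 1 / 4 by norm_num)
    (show (1 - (1 / 64) ^ 2 : ℝ) < 1 by norm_num)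
  refine ⟨n + 4 + 1, by omega, fun y hy hy' => ?_⟩
  have h0 : (0 : ℝ) ≤ 1 - y ^ 2 := by nlinarith
  have h1 : (1 - y ^ 2) ^ (n + 4) ≤ 1 / 4 :=
    calc (1 - y ^ 2) ^ (n + 4) ≤ (1 - y ^ 2) ^ n :=
          pow_le_pow_of_le_one h0 (by nlinarith) (by omega)
      _ ≤ (1 - (1 / 64) ^ 2) ^ n := pow_le_pow_left₀ h0 (by nlinarith) n
      _ ≤ 1 / 4 := hn.le
  rw [pow_succ]
  have h2 := mul_le_mul_of_nonneg_right h1 h0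
  nlinarith

/-- A vertex adjacent to `d ≥ a / 64` of the `a` candidate hubs is adjacent to both members of some
pair in a proportion of at least `(1 + d / a) / 2` of the tuples of pairs. -/
theorem full_tuples_ge {ι α : Type*} [Fintype ι] [Fintype α] [DecidableEq ι]
    (P : α → Prop) [DecidablePred P] (hα : 0 < Fintype.card α)
    (hq : ∀ y : ℝ, 1 / 64 ≤ y → y ≤ 1 → 2 * (1 - y ^ 2) ^ Fintype.card ι ≤ 1 - y)
    (hP : (Fintype.card α : ℝ) ≤ 64 * (Finset.univ.filter P).card) :
    (Fintype.card α : ℝ) ^ (2 * Fintype.card ι) *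
        (1 + (Finset.univ.filter P).card / Fintype.card α) ≤
      2 * (Finset.univ.filter fun f : ι × Bool → α => ∃ i, ∀ b, P (f (i, b))).card := by
  classical
  have hd : (Finset.univ.filter P).card ≤ Fintype.card α := Finset.card_le_univ _
  rw [card_filter_eq_card_sub fun f : ι × Bool → α => ∃ i, ∀ b, P (f (i, b)),
    Fintype.card_fun]
  simp only [not_exists]
  rw [card_forall_not_full, Nat.cast_pow (_ - _), Nat.cast_sub (Nat.pow_le_pow_left hd 2)]
  have ha : (0 : ℝ) < Fintype.card α := by exact_mod_cast hα
  have hd' : ((Finset.univ.filter P).card : ℝ) ≤ Fintype.card α := by exact_mod_cast hd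
  have hc : Fintype.card (ι × Bool) = 2 * Fintype.card ι := by simp [mul_comm]
  rw [hc]
  generalize (Finset.univ.filter P).card = d at *
  generalize Fintype.card α = a at *
  generalize Fintype.card ι = q at *
  have key := hq (d / a) (by rw [le_div_iff₀ ha]; linarith) (by rw [div_le_one ha]; exact hd')
  have hpow : ((a : ℝ) ^ 2 - (d : ℝ) ^ 2) ^ q = (a : ℝ) ^ (2 * q) * (1 - (d / a : ℝ) ^ 2) ^ q := by
    rw [pow_mul, ← mul_pow]
    congr 1
    field_simp
  push_cast
  rw [hpow]
  have := mul_le_mul_of_nonneg_left key (pow_nonneg ha.le (2 * q))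
  linarith

/-- A vertex adjacent to `d ≤ a / 8` of the `a` candidate hubs is adjacent to some hub in a
proportion of at least `4d / a` of the tuples of pairs. -/
theorem seen_tuples_ge {ι α : Type*} [Fintype ι] [Fintype α] [DecidableEq ι]
    (P : α → Prop) [DecidablePred P] (hα : 0 < Fintype.card α) (hq : 4 ≤ Fintype.card ι)
    (hP : 8 * ((Finset.univ.filter P).card : ℝ) ≤ Fintype.card α) :
    (Fintype.card α : ℝ) ^ (2 * Fintype.card ι) *
        (4 * ((Finset.univ.filter P).card / Fintype.card α)) ≤
      (Finset.univ.filter fun f : ι × Bool → α => ∃ i b, P (f (i, b))).card := by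
  classical
  have hd : (Finset.univ.filter P).card ≤ Fintype.card α := Finset.card_le_univ _
  rw [card_filter_eq_card_sub fun f : ι × Bool → α => ∃ i b, P (f (i, b)),
    Fintype.card_fun]
  simp only [not_exists]
  rw [card_forall_not_seen, Nat.cast_pow (_ - _), Nat.cast_sub hd]
  have ha : (0 : ℝ) < Fintype.card α := by exact_mod_cast hα
  have hc : Fintype.card (ι × Bool) = 2 * Fintype.card ι := by simp [mul_comm]
  rw [hc]
  generalize (Finset.univ.filter P).card = d at *
  generalize Fintype.card α = a at *
  generalize Fintype.card ι = q at *
  have key := four_mul_le_one_sub_pow (x := d / a) (by positivity)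
    (by rw [div_le_iff₀ ha]; linarith) (N := 2 * q) (by omega)
  have hpow : ((a : ℝ) - d) ^ (2 * q) = (a : ℝ) ^ (2 * q) * (1 - (d / a : ℝ)) ^ (2 * q) := by
    rw [← mul_pow]
    congr 1
    field_simp
  push_cast
  rw [hpow]
  have := mul_le_mul_of_nonneg_left key (pow_nonneg ha.le (2 * q))
  linarith

/-! ### The upper bound -/

theorem adjPairs_eq_of_subset {V : Type*} [DecidableEq V] {G : SimpleGraph V} {X Y : Finset V}
    (hXY : X ⊆ Y) (h : ∀ y ∈ Y \ X, ∀ z ∈ Y, ¬ G.Adj y z) : adjPairs G Y Y = adjPairs G X X := by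
  have h1 := adjPairs_union_self G (Finset.disjoint_sdiff (s := X) (t := Y))
  rw [Finset.union_sdiff_of_subset hXY, adjPairs_eq_zero fun y hy z hz => h y hy z (hXY hz),
    adjPairs_eq_zero fun y hy z hz => h y hy z (Finset.mem_sdiff.1 hz).1] at h1
  omega

/-- A set maximizing the number of inner edges minus `t` times its size has minimum degree at
least `t`, and any set of further vertices brings at most `t` new edges per vertex. -/
theorem exists_dense_core {V : Type*} [DecidableEq V] (G : SimpleGraph V) (U : Finset V) (t : ℝ) :
    ∃ A ⊆ U, (∀ w ∈ A, t ≤ degIn G A w) ∧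
      ∀ S ⊆ U \ A, 2 * (adjPairs G S A : ℝ) + adjPairs G S S ≤ 2 * t * S.card := by
  obtain ⟨A, hA, hmax⟩ := Finset.exists_max_image U.powerset
    (fun A => (adjPairs G A A : ℝ) - 2 * t * A.card) ⟨∅, by simp⟩
  rw [Finset.mem_powerset] at hA
  refine ⟨A, hA, fun w hw => ?_, fun S hS => ?_⟩
  · have h1 := hmax (A.erase w)
      (Finset.mem_powerset.2 ((Finset.erase_subset _ _).trans hA))
    have h2 := adjPairs_union_self G (show Disjoint (A.erase w) {w} by simp)
    have h3 : A.erase w ∪ {w} = A := by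
      ext x; by_cases h : x = w <;> simp [h, hw]
    have h4 : degIn G (A.erase w) w ≤ degIn G A w :=
      degIn_mono G (Finset.erase_subset _ _) w
    rw [h3, adjPairs_singleton_left, adjPairs_singleton_self] at h2
    have h5 := Finset.card_erase_add_one hw
    rw [h2, ← h5] at h1
    have h4' : (degIn G (A.erase w) w : ℝ) ≤ degIn G A w := by exact_mod_cast h4
    push_cast at h1
    linarith
  · have hd : Disjoint A S :=
      Finset.disjoint_left.2 fun x hx hx' => (Finset.mem_sdiff.1 (hS hx')).2 hx
    have h1 := hmax (A ∪ S) (Finset.mem_powerset.2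
      (Finset.union_subset hA (hS.trans Finset.sdiff_subset)))
    rw [adjPairs_union_self G hd, Finset.card_union_of_disjoint hd] at h1
    push_cast at h1
    linarith

theorem card_filter_subtype_adj {V : Type*} (G : SimpleGraph V) (A : Finset V) (w : V)
    [DecidablePred fun u : A => G.Adj w u] :
    (Finset.univ.filter fun u : A => G.Adj w u).card = degIn G A w := by
  classical
  rw [degIn]
  refine Finset.card_bij (fun u _ => u.1) (fun u hu => ?_) (fun u _ v _ h => Subtype.ext h)
    fun u hu => ?_
  · simpa using hu
  · rw [Finset.mem_filter] at hu
    exact ⟨⟨u, hu.1⟩, by simpa using hu.2, rfl⟩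

theorem sum_card_filter_comm {β V : Type*} [Fintype β] (A : Finset V) (R : β → V → Prop)
    [∀ f w, Decidable (R f w)] :
    ∑ f, ((A.filter (R f)).card : ℝ) =
      ∑ w ∈ A, ((Finset.univ.filter fun f => R f w).card : ℝ) := by
  classical
  simp_rw [Finset.card_filter]
  push_cast
  exact Finset.sum_comm

/-- The consequence of averaging the yield over all tuples of `q` pairs of hubs in `A`. Two ways of
using the vertices of `U \ A` are averaged with equal weight: attaching them to hubs, or adding the
edges of a `P₅`-free graph `S` outside `A`. -/
theorem average_yield_le {V : Type*} [Fintype V] [DecidableEq V] {G : SimpleGraph V} {k : ℕ}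
    (hk : turanNumber G (pathWithEdges 5) < k) {A U : Finset V} (hAU : A ⊆ U) (hA : A.Nonempty)
    (hU : U.card ≤ 2 * k) {S : SimpleGraph V} [Fintype S.edgeSet] (hSG : S ≤ G)
    (hS : (pathWithEdges 5).Free S) (hSA : ∀ x y, S.Adj x y → x ∉ A) {q : ℕ} (hq4 : 4 ≤ q)
    (hq : ∀ y : ℝ, 1 / 64 ≤ y → y ≤ 1 → 2 * (1 - y ^ 2) ^ q ≤ 1 - y)
    (hfull : ∀ w ∈ A, (A.card : ℝ) ≤ 64 * degIn G A w)
    (hseen : ∀ w ∈ U \ A, 8 * (degIn G A w : ℝ) ≤ A.card) :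
    (A.card : ℝ) ^ 2 + adjPairs G A A + 2 * adjPairs G (U \ A) A +
      A.card * (S.edgeFinset.card : ℝ) / 2 ≤ A.card * (k + 4 * q) + 20 * q ^ 2 * k := by
  classical
  have hne : Nonempty (Fin q) := ⟨⟨0, by omega⟩⟩
  have ha : (0 : ℝ) < A.card := by exact_mod_cast hA.card_pos
  have hcA : Fintype.card A = A.card := Fintype.card_coe A
  have hcq : Fintype.card (Fin q × Bool) = 2 * q := by simp [mul_comm]
  let full : (Fin q × Bool → A) → V → Prop := fun f w => ∃ i, ∀ b, G.Adj w (f (i, b))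
  let seen : (Fin q × Bool → A) → V → Prop := fun f w => ∃ i b, G.Adj w (f (i, b))
  have hs := card_edgeFinset_lt_of_turanNumber_lt hk hSG hS
  have hs' : (S.edgeFinset.card : ℝ) ≤ k := by exact_mod_cast hs.le
  let F : (Fin q × Bool → A) → ℝ := fun f => 2 * ((A.filter (full f)).card : ℝ) +
    ((U \ A).filter (seen f)).card / 2 + S.edgeFinset.card / 2
  have hF1 : ∀ f, Function.Injective f → F f ≤ k + 4 * q := by
    intro f hf
    have hinj : Function.Injective fun p => (f p : V) := Subtype.val_injective.comp hf
    have h1 := hub_yield_le hk hAU hinj (fun p => (f p).2) (S := ⊥) bot_le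
      (by rw [pathWithEdges_five_free_iff]; rintro ⟨v, -, h, -⟩; exact h)
      (fun x y h => h.elim)
    have h2 := hub_yield_le hk subset_rfl hinj (fun p => (f p).2) hSG hS hSA
    rw [Finset.sdiff_self, Finset.filter_empty, Finset.card_empty] at h2
    rw [Fintype.card_fin] at h1 h2
    have h1' : 2 * ((A.filter (full f)).card : ℝ) + ((U \ A).filter (seen f)).card ≤ k + 4 * q := by
      have h1n : 2 * (A.filter (full f)).card + ((U \ A).filter (seen f)).card ≤ k + 4 * q := by
        exact le_of_eq_of_le (by congr!) ((Nat.le_add_right _ _).trans h1)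
      exact_mod_cast h1n
    have h2' : 2 * ((A.filter (full f)).card : ℝ) + S.edgeFinset.card ≤ k + 4 * q := by
      have h2n : 2 * (A.filter (full f)).card + S.edgeFinset.card ≤ k + 4 * q := by
        rw [add_zero] at h2
        exact le_of_eq_of_le (by congr!) h2
      exact_mod_cast h2n
    simp only [F]
    linarith
  have hF2 : ∀ f, F f ≤ 5 * k := by
    intro f
    have h1 : ((A.filter (full f)).card : ℝ) ≤ A.card := by
      exact_mod_cast Finset.card_filter_le _ _
    have h2 : (((U \ A).filter (seen f)).card : ℝ) ≤ (U \ A).card := by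
      exact_mod_cast Finset.card_filter_le _ _
    have h3 : ((U \ A).card : ℝ) + A.card ≤ 2 * k := by
      exact_mod_cast (Finset.card_sdiff_add_card_eq_card hAU).trans_le hU
    have h4 : (0 : ℝ) ≤ (U \ A).card := Nat.cast_nonneg _
    simp only [F]
    linarith
  have hupper := card_mul_sum_le_of_injective (by positivity) (by positivity) hF1 hF2
  rw [hcA, hcq] at hupper
  have hsum : (A.card : ℝ) ^ (2 * q) * (A.card + adjPairs G A A / A.card +
      2 * (adjPairs G (U \ A) A / A.card) + S.edgeFinset.card / 2) ≤ ∑ f, F f := by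
    simp only [F]
    rw [Finset.sum_add_distrib, Finset.sum_add_distrib, ← Finset.mul_sum, ← Finset.sum_div,
      sum_card_filter_comm, sum_card_filter_comm, Finset.sum_const, Finset.card_univ,
      Fintype.card_fun, hcA, hcq, nsmul_eq_mul]
    have h1 : (A.card : ℝ) ^ (2 * q) * (A.card + adjPairs G A A / A.card) ≤
        2 * ∑ w ∈ A, ((Finset.univ.filter fun f => full f w).card : ℝ) := by
      have : (A.card : ℝ) + adjPairs G A A / A.card =
          ∑ w ∈ A, (1 + (degIn G A w : ℝ) / A.card) := by
        rw [Finset.sum_add_distrib, ← Finset.sum_div, adjPairs]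
        simp
      rw [this, Finset.mul_sum, Finset.mul_sum]
      refine Finset.sum_le_sum fun w hw => ?_
      have := full_tuples_ge (ι := Fin q) (fun u : A => G.Adj w u) (by rw [hcA]; exact hA.card_pos)
        (by simpa using hq) (by rw [hcA, card_filter_subtype_adj]; exact hfull w hw)
      rw [hcA, card_filter_subtype_adj, Fintype.card_fin] at this
      exact this.trans_eq (by congr!)
    have h2 : (A.card : ℝ) ^ (2 * q) * (4 * (adjPairs G (U \ A) A / A.card)) ≤
        ∑ w ∈ U \ A, ((Finset.univ.filter fun f => seen f w).card : ℝ) := by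
      have : 4 * ((adjPairs G (U \ A) A : ℝ) / A.card) =
          ∑ w ∈ U \ A, 4 * ((degIn G A w : ℝ) / A.card) := by
        rw [← Finset.mul_sum, ← Finset.sum_div, adjPairs]
        simp
      rw [this, Finset.mul_sum]
      refine Finset.sum_le_sum fun w hw => ?_
      have := seen_tuples_ge (ι := Fin q) (fun u : A => G.Adj w u) (by rw [hcA]; exact hA.card_pos)
        (by simpa using hq4) (by rw [hcA, card_filter_subtype_adj]; exact hseen w hw)
      rw [hcA, card_filter_subtype_adj, Fintype.card_fin] at this
      exact this.trans_eq (by congr!)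
    push_cast
    linarith
  have h3 := (mul_le_mul_of_nonneg_left hsum ha.le).trans hupper
  rw [mul_left_comm] at h3
  have h4 := le_of_mul_le_mul_left h3 (pow_pos ha _)
  have h5 : (A.card : ℝ) * (A.card + adjPairs G A A / A.card +
      2 * (adjPairs G (U \ A) A / A.card) + S.edgeFinset.card / 2) =
      (A.card : ℝ) ^ 2 + adjPairs G A A + 2 * adjPairs G (U \ A) A +
      A.card * (S.edgeFinset.card : ℝ) / 2 := by
    field_simp
  rw [h5] at h4
  push_cast at h4
  linarith

/-- A `P₅`-free subgraph on `B` with enough edges to pay for the edges inside `B`, when every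
subset of `B` spans few edges. -/
theorem exists_free_subgraph_within {V : Type*} [Fintype V] [DecidableEq V] (G : SimpleGraph V)
    (B : Finset V) {t : ℝ} (ht : 0 ≤ t)
    (hB : ∀ S ⊆ B, (adjPairs G S S : ℝ) ≤ 2 * t * S.card) :
    ∃ (S : SimpleGraph V) (_ : Fintype S.edgeSet), S ≤ G ∧ (pathWithEdges 5).Free S ∧
      (∀ x y, S.Adj x y → x ∈ B) ∧ (adjPairs G B B : ℝ) ≤ 4 * t * S.edgeFinset.card := by
  classical
  let GB : SimpleGraph V :=
    { Adj := fun x y => G.Adj x y ∧ x ∈ B ∧ y ∈ B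
      symm := ⟨fun _ _ h => ⟨h.1.symm, h.2.2, h.2.1⟩⟩
      loopless := ⟨fun _ h => G.irrefl h.1⟩ }
  obtain ⟨S, hSG, hS, hcov⟩ := exists_free_spanning_subgraph GB
  refine ⟨S, inferInstance, fun x y h => (hSG h).1, hS, fun x y h => (hSG h).2.1, ?_⟩
  have h1 : adjPairs G B B = adjPairs G (B.filter fun x => ∃ y ∈ B, G.Adj x y)
      (B.filter fun x => ∃ y ∈ B, G.Adj x y) := by
    refine adjPairs_eq_of_subset (Finset.filter_subset _ _) fun y hy z hz hyz => ?_
    rw [Finset.mem_sdiff, Finset.mem_filter] at hy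
    exact hy.2 ⟨hy.1, z, hz, hyz⟩
  have h2 : (B.filter fun x => ∃ y ∈ B, G.Adj x y).card ≤ 2 * S.edgeFinset.card := by
    refine card_le_twice_card_edgeFinset fun x hx => ?_
    obtain ⟨hxB, y, hy, hxy⟩ := Finset.mem_filter.1 hx
    exact hcov x ⟨y, hxy, hxB, hy⟩
  have h2' : ((B.filter fun x => ∃ y ∈ B, G.Adj x y).card : ℝ) ≤ 2 * S.edgeFinset.card := by
    exact_mod_cast h2
  rw [h1]
  refine (hB _ (Finset.filter_subset _ _)).trans ?_
  nlinarith

/-- A graph with `ex(G, P₅) < k` has at most `(k + C)² / 8` edges. -/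
theorem exists_card_edgeFinset_le :
    ∃ C : ℝ, 0 ≤ C ∧ ∀ (V : Type) [Fintype V] (G : SimpleGraph V) [Fintype G.edgeSet] (k : ℕ),
      turanNumber G (pathWithEdges 5) < k → 8 * (G.edgeFinset.card : ℝ) ≤ (k + C) ^ 2 := by
  classical
  obtain ⟨q, hq4, hq⟩ := exists_two_mul_one_sub_sq_pow_le
  refine ⟨4 * q + 80 * q ^ 2, by positivity, fun V _ G _ k hk => ?_⟩
  have hkpos : (0 : ℝ) < k := by
    rcases Nat.eq_zero_or_pos k with rfl | h
    · simp at hk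
    · exact_mod_cast h
  by_cases hm : 8 * (G.edgeFinset.card : ℝ) ≤ k ^ 2
  · refine hm.trans (pow_le_pow_left₀ hkpos.le ?_ 2)
    have : (0 : ℝ) ≤ 4 * q + 80 * q ^ 2 := by positivity
    linarith
  push Not at hm
  set U : Finset V := Finset.univ.filter fun v => ∃ u, G.Adj v u with hUdef
  have hU : U.card ≤ 2 * k :=
    card_le_of_turanNumber_lt hk fun v hv => (Finset.mem_filter.1 hv).2
  have hUr : (U.card : ℝ) ≤ 2 * k := by exact_mod_cast hU
  have hUm : (adjPairs G U U : ℝ) = 2 * G.edgeFinset.card := by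
    rw [← adjPairs_eq_of_subset (Finset.subset_univ U), adjPairs_univ]
    · push_cast; rfl
    · intro y hy z _ hyz
      exact (Finset.mem_sdiff.1 hy).2 (Finset.mem_filter.2 ⟨Finset.mem_univ _, z, hyz⟩)
  -- As `k / 4 ≤ |A| ≤ 2k` below, the threshold `k / 32` lies between `|A| / 64` and `|A| / 8`.
  obtain ⟨A, hAU, hAdeg, hBS⟩ := exists_dense_core G U ((k : ℝ) / 32)
  have hsplit : (adjPairs G U U : ℝ) =
      adjPairs G A A + 2 * adjPairs G (U \ A) A + adjPairs G (U \ A) (U \ A) := by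
    have := adjPairs_union_self G (Finset.disjoint_sdiff (s := A) (t := U))
    rw [Finset.union_sdiff_of_subset hAU] at this
    exact_mod_cast this
  have hAr : (A.card : ℝ) ≤ 2 * k :=
    le_trans (by exact_mod_cast Finset.card_le_card hAU) hUr
  -- Few edges leave the core, so the core carries almost all edges and is large.
  have hAk : (k : ℝ) / 4 ≤ A.card := by
    have h1 := hBS _ subset_rfl
    have h2 : ((U \ A).card : ℝ) ≤ 2 * k :=
      le_trans (by exact_mod_cast Finset.card_le_card Finset.sdiff_subset) hUr
    have h3 : (adjPairs G A A : ℝ) ≤ A.card * A.card := by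
      exact_mod_cast (adjPairs_self_le G A).trans (Nat.mul_le_mul_left _ (Nat.sub_le _ _))
    have h4 := mul_le_mul_of_nonneg_left h2 hkpos.le
    by_contra hlt
    push Not at hlt
    have h0 : (0 : ℝ) ≤ A.card := Nat.cast_nonneg _
    nlinarith
  have hApos : (0 : ℝ) < A.card := by linarith
  obtain ⟨S, _, hSG, hS, hSB, hSedges⟩ := exists_free_subgraph_within G (U \ A)
    (t := (k : ℝ) / 32) (by positivity) fun T hT => by
      have h1 := hBS T hT
      have h2 : (0 : ℝ) ≤ adjPairs G T A := Nat.cast_nonneg _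
      linarith
  have havg := average_yield_le hk hAU (Finset.card_pos.1 (by exact_mod_cast hApos)) hU hSG hS
    (fun x y h => (Finset.mem_sdiff.1 (hSB x y h)).2) hq4 hq
    (fun w hw => by have := hAdeg w hw; linarith)
    (fun w hw => by
      have h1 := hBS {w} (Finset.singleton_subset_iff.2 hw)
      rw [adjPairs_singleton_left, adjPairs_singleton_self, Finset.card_singleton] at h1
      push_cast at h1
      linarith)
  have hs : (0 : ℝ) ≤ S.edgeFinset.card := Nat.cast_nonneg _
  have hSedges' : (adjPairs G (U \ A) (U \ A) : ℝ) ≤ A.card * (S.edgeFinset.card : ℝ) / 2 := by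
    refine hSedges.trans ?_
    nlinarith
  have herr : 20 * (q : ℝ) ^ 2 * k ≤ A.card * (80 * (q : ℝ) ^ 2) := by
    have := mul_le_mul_of_nonneg_left hAk (show (0 : ℝ) ≤ 80 * (q : ℝ) ^ 2 by positivity)
    linarith
  have hfinal : (A.card : ℝ) ^ 2 + 2 * G.edgeFinset.card ≤
      A.card * (k + (4 * q + 80 * q ^ 2)) := by
    rw [← hUm, hsplit]
    linarith
  -- The arithmetic-geometric mean inequality in the form `4 a (K - a) ≤ K ^ 2`.
  nlinarith [sq_nonneg (2 * (A.card : ℝ) - (k + (4 * q + 80 * q ^ 2)))]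

/-! ### The inverse Turán number -/

theorem turanNumber_top_le (n : ℕ) :
    turanNumber (⊤ : SimpleGraph (Fin n)) (pathWithEdges 5) ≤ ((2 * n : ℕ) : ℕ∞) := by
  classical
  refine sSup_le ?_
  rintro m ⟨H, -, hH, rfl⟩
  rw [← SimpleGraph.coe_edgeFinset, Set.encard_coe_eq_coe_finsetCard]
  have := card_edgeFinset_le_of_free hH
  rw [Fintype.card_fin] at this
  exact_mod_cast this

theorem choose_two_le_inverseTuranNumber {n k : ℕ} (h : 2 * n < k) :
    ((n.choose 2 : ℕ) : ℕ∞) ≤ inverseTuranNumber k (pathWithEdges 5) := by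
  classical
  refine le_sSup ⟨Fin n, inferInstance, ⊤,
    (turanNumber_top_le n).trans_lt (by exact_mod_cast h), ?_⟩
  rw [← SimpleGraph.coe_edgeFinset, Set.encard_coe_eq_coe_finsetCard,
    SimpleGraph.card_edgeFinset_top_eq_card_choose_two, Fintype.card_fin]

theorem inverseTuranNumber_le_floor {C : ℝ}
    (hC : ∀ (V : Type) [Fintype V] (G : SimpleGraph V) [Fintype G.edgeSet] (k : ℕ),
      turanNumber G (pathWithEdges 5) < k → 8 * (G.edgeFinset.card : ℝ) ≤ (k + C) ^ 2) (k : ℕ) :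
    inverseTuranNumber k (pathWithEdges 5) ≤ (⌊((k : ℝ) + C) ^ 2 / 8⌋₊ : ℕ∞) := by
  classical
  refine sSup_le ?_
  rintro m ⟨V, hV, G, hG, rfl⟩
  have := Fintype.ofFinite V
  rw [← SimpleGraph.coe_edgeFinset, Set.encard_coe_eq_coe_finsetCard]
  have h := hC V G k hG
  have h2 : G.edgeFinset.card ≤ ⌊((k : ℝ) + C) ^ 2 / 8⌋₊ := Nat.le_floor (by linarith)
  exact_mod_cast h2

theorem mainTheorem2 :
    (∀ k : ℕ, inverseTuranNumber k (pathWithEdges 5) ≠ ⊤) ∧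
      (fun k : ℕ => ((inverseTuranNumber k (pathWithEdges 5)).toNat : ℝ) - (k : ℝ) ^ 2 / 8)
        =O[atTop] (fun k : ℕ => (k : ℝ)) := by
  obtain ⟨C, hC0, hC⟩ := exists_card_edgeFinset_le
  have hle := inverseTuranNumber_le_floor hC
  have hfin : ∀ k : ℕ, inverseTuranNumber k (pathWithEdges 5) ≠ ⊤ := fun k =>
    ((hle k).trans_lt (ENat.natCast_lt_top _)).ne
  refine ⟨hfin, IsBigO.of_bound (1 + 2 * C + C ^ 2) ?_⟩
  filter_upwards [eventually_ge_atTop 4] with k hk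
  have hk' : (4 : ℝ) ≤ k := by exact_mod_cast hk
  rw [Real.norm_eq_abs, Real.norm_of_nonneg (Nat.cast_nonneg k), abs_le]
  constructor
  · have h1 := ENat.toNat_le_toNat
      (choose_two_le_inverseTuranNumber (show 2 * ((k - 1) / 2) < k by omega)) (hfin k)
    rw [ENat.toNat_natCast] at h1
    have h2 : (((k - 1) / 2).choose 2 : ℝ) ≤ (inverseTuranNumber k (pathWithEdges 5)).toNat := by
      exact_mod_cast h1
    rw [Nat.cast_choose_two] at h2
    have h3 : (k : ℝ) - 2 ≤ 2 * ((k - 1) / 2 : ℕ) := by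
      have : k ≤ 2 * ((k - 1) / 2) + 2 := by omega
      have : (k : ℝ) ≤ 2 * ((k - 1) / 2 : ℕ) + 2 := by exact_mod_cast this
      linarith
    have h4 : ((k : ℝ) - 2) * (k - 4) ≤
        (2 * ((k - 1) / 2 : ℕ)) * (2 * ((k - 1) / 2 : ℕ) - 2) := by
      apply mul_le_mul h3 (by linarith) (by linarith) (by linarith)
    have h5 : 0 ≤ (2 * C + C ^ 2) * (k : ℝ) := by positivity
    nlinarith
  · have h1 := ENat.toNat_le_toNat (hle k) (ENat.natCast_ne_top _)
    rw [ENat.toNat_natCast] at h1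
    have h2 : ((inverseTuranNumber k (pathWithEdges 5)).toNat : ℝ) ≤ ((k : ℝ) + C) ^ 2 / 8 :=
      le_trans (by exact_mod_cast h1) (Nat.floor_le (by positivity))
    have h3 : C ^ 2 * 1 ≤ C ^ 2 * (k : ℝ) :=
      mul_le_mul_of_nonneg_left (by linarith) (sq_nonneg C)
    have h4 : 0 ≤ C * (k : ℝ) := by positivity
    nlinarith
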